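/- Let $n\ge1$ and let $p:\mathbb R^n\to[1,\infty)$ be measurable with $1<p^-:=\operatorname{ess\,inf}p\le p^+:=\operatorname{ess\,sup}p<\infty$ and $1/p$ log-Hölder continuous, i.e. for some $L>0$ $$\Big|\tfrac1{p(x)}-\tfrac1{p(y)}\Big|\le \frac{L}{\log(e+1/|x-y|)}\qquad\text{for all }x\ne y\text{ in }\mathbb R^n .$$ Let $\mathcal A:\mathbb R^n\times\mathbb R\times\mathbb R^n\to\mathbb R^n$ be a Carathéodory function (measurable in the first argument, continuous in the latter two) for which there are measurable functions $a\le b$ on $\mathbb R^n$, with $a\ge a_-$ for a constant $a_->0$ and $b\le b^+$ for a constant $b^+<\infty$, such that for all $(x,s,\xi)$ $$\langle\mathcal A(x,s,\xi),\xi\rangle\ge a(x)|\xi|^{p(x)},\qquad |\mathcal A(x,s,\xi)|\le b(x)|\xi|^{p(x)-1}.$$ Let $f:\mathbb R\to[0,\infty)$ be continuous with exactly one zero $t\in\mathbb R$. A function $u\in W^{1,p(\cdot)}_{loc}(\mathbb R^n)$ is called a supersolution of $\operatorname{div}\mathcal A(x,u,\nabla u)=f(u)$ in $\mathbb R^n$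 if $$-\int_{\mathbb R^n}\langle\mathcal A(x,u,\nabla u),\nabla\phi\rangle\,dx\ \ge\ \int_{\mathbb R^n}f(u)\,\phi\,dx\qquad\text{for all }0\le\phi\in C_0^\infty(\mathbb R^n).$$ **Theorem.** If $p^->n$, then every (essentially) bounded supersolution $u$ is constant: $u=t$ almost everywhere in $\mathbb R^n$. -/

import Mathlib

open MeasureTheory Filter
open scoped ContDiff ENNReal

noncomputable section

/-- Euclidean space `ℝⁿ`, with the Euclidean norm and Lebesgue measure `volume`. -/
abbrev RSpace (n : ℕ) : Type := EuclideanSpace ℝ (Fin n)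

namespace VarExp

variable {n : ℕ}

/-- `p⁻`, the essential infimum of the exponent over `ℝⁿ`
(used only for exponents which are bounded, so that it is a genuine infimum). -/
def pMinus (p : RSpace n → ℝ) : ℝ := essInf p volume

/-- Global log-Hölder continuity on `ℝⁿ`. At `x = y` the condition is trivially true. -/
def LogHolder (α : RSpace n → ℝ) : Prop :=
  ∃ L : ℝ, 0 < L ∧ ∀ x y : RSpace n,
    |α x - α y| ≤ L / Real.log (Real.exp 1 + 1 / ‖x - y‖)

/-- A bounded log-Hölder continuous variable exponent on `ℝⁿ`:
`p` is measurable with values in `[1, ∞)`, `1/p` is log-Hölder continuous,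
and `1 < p⁻ ≤ p⁺ < ∞`. -/
structure IsBoundedLogHolderExponent (p : RSpace n → ℝ) : Prop where
  aemeasurable : AEMeasurable p volume
  one_le : ∀ x, 1 ≤ p x
  bounded : ∃ P : ℝ, ∀ᵐ x ∂(volume : Measure (RSpace n)), p x ≤ P
  one_lt_pMinus : 1 < pMinus p
  logHolder : LogHolder (fun x => 1 / p x)

/-- The modular `∫_S |u(x)|^{p(x)} dx`, with values in `[0, ∞]`. -/
def modular {F : Type*} [NormedAddCommGroup F] (p : RSpace n → ℝ) (S : Set (RSpace n))
    (u : RSpace n → F) : ℝ≥0∞ :=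
  ∫⁻ x in S, ‖u x‖ₑ ^ p x

/-- Membership in the variable exponent Lebesgue space `L^{p(·)}(S)`: `u` is (Lebesgue) measurable
on `S` and the modular of `u / μ` is finite for some `μ > 0`. -/
def MemVarLp {F : Type*} [NormedAddCommGroup F] [NormedSpace ℝ F] (p : RSpace n → ℝ)
    (S : Set (RSpace n)) (u : RSpace n → F) : Prop :=
  AEStronglyMeasurable u (volume.restrict S) ∧
    ∃ μ : ℝ, 0 < μ ∧ modular p S (fun x => μ⁻¹ • u x) < ⊤

/-- `φ ∈ C₀^∞(ℝⁿ)`. -/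
def IsTestFunction (φ : RSpace n → ℝ) : Prop :=
  ContDiff ℝ ∞ φ ∧ HasCompactSupport φ

/-- `g` is the distributional gradient of `u` on `ℝⁿ`. -/
structure IsWeakGradient (u : RSpace n → ℝ) (g : RSpace n → RSpace n) : Prop where
  locallyIntegrable : LocallyIntegrable u volume
  locallyIntegrable_grad : LocallyIntegrable g volume
  integral_eq : ∀ φ : RSpace n → ℝ, IsTestFunction φ → ∀ i : Fin n,
    ∫ x, u x * gradient φ x i = - ∫ x, g x i * φ x

/-- `u ∈ W^{1,p(·)}_loc(ℝⁿ)` with distributional gradient `g` (unique up to null sets). -/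
structure MemSobolevLoc (p : RSpace n → ℝ) (u : RSpace n → ℝ) (g : RSpace n → RSpace n) :
    Prop where
  weakGradient : IsWeakGradient u g
  memVarLp : ∀ K : Set (RSpace n), IsCompact K → MemVarLp p K u
  memVarLp_grad : ∀ K : Set (RSpace n), IsCompact K → MemVarLp p K g

/-- Carathéodory functions `A : ℝⁿ × ℝ × ℝⁿ → ℝⁿ`: Lebesgue measurable in the first
argument and (jointly) continuous in the latter two. -/
structure IsCaratheodory (A : RSpace n → ℝ → RSpace n → RSpace n) : Prop where
  aemeasurable : ∀ (t : ℝ) (ξ : RSpace n), AEMeasurable (fun x => A x t ξ) volume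
  continuous : ∀ x : RSpace n, Continuous (fun z : ℝ × RSpace n => A x z.1 z.2)

/-- Carathéodory functions of `p(·)`-growth. -/
structure HasVarGrowth (p : RSpace n → ℝ) (A : RSpace n → ℝ → RSpace n → RSpace n) :
    Prop where
  caratheodory : IsCaratheodory A
  growth : ∃ a b : RSpace n → ℝ,
    AEMeasurable a volume ∧ AEMeasurable b volume ∧
    (∃ aMinus : ℝ, 0 < aMinus ∧ ∀ x, aMinus ≤ a x) ∧
    (∃ bPlus : ℝ, ∀ x, b x ≤ bPlus) ∧
    (∀ x, a x ≤ b x) ∧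
    (∀ x t ξ, a x * ‖ξ‖ ^ p x ≤ inner ℝ (A x t ξ) ξ) ∧
    (∀ x t ξ, ‖A x t ξ‖ ≤ b x * ‖ξ‖ ^ (p x - 1))

/-- Supersolutions of `div A(x,u,∇u) = f(u)` in `ℝⁿ`: `u ∈ W^{1,p(·)}_loc(ℝⁿ)` and
`-∫ ⟨A(x,u,∇u), ∇φ⟩ ≥ ∫ f(u) φ` for all nonnegative `φ ∈ C₀^∞(ℝⁿ)`.
The left integrand is integrable by the growth condition on `A`, the right one whenever
`f` is continuous and `u` is (locally) essentially bounded. -/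
def IsSupersolution (p : RSpace n → ℝ) (A : RSpace n → ℝ → RSpace n → RSpace n)
    (f : ℝ → ℝ) (u : RSpace n → ℝ) : Prop :=
  ∃ g : RSpace n → RSpace n, MemSobolevLoc p u g ∧
    ∀ φ : RSpace n → ℝ, IsTestFunction φ → (∀ x, 0 ≤ φ x) →
      ∫ x, f (u x) * φ x ≤ - ∫ x, inner ℝ (A x (u x) (g x)) (gradient φ x)

end VarExp

end

noncomputable section

namespace VarExp

variable {n : ℕ}

open scoped Topology Convolution

open ContinuousLinearMap (lsmul)

/-! Since f is nonnegative, the field h = A(x,u,∇u) satisfies ∫⟨h,∇φ⟩ ≤ 0 for all test functions φ ≥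
0. Testing with (u+M)η^N, where |u| ≤ M and η is a cutoff at scale R, gives ∫η^N⟨h,∇u⟩ ≤
2M∫|h||∇η^N|. Coercivity, growth and absorption turn this into a Caccioppoli inequality whose right
side is a multiple of ∫|∇η|^p. For large R that integral is at most a constant times R^(n-p⁻), which
tends to 0 because p⁻ > n. Hence ∇u = 0 and h = 0, so ∫f(u)φ ≤ 0 for every φ ≥ 0. This forces f(u) =
0, that is u = t (`ae_eq_zero_of_subsolution`, `ae_eq_zero_of_integral_mul_nonpos`).

The function (u+M)η^N is not smooth, so u is mollified first. Log-Hölder continuity bounds |ρ*∇u|^p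
pointwise by a constant times ρ*(1+|∇u|^p) (`norm_convolution_rpow_le`). Only an upper bound on the
limit integral is needed, so Fatou's lemma with this moving majorant suffices
(`integral_mul_inner_le_of_mollify`). -/

/-! ### Limit and measurability tools. -/

/-- The dominated convergence bound that follows from Fatou's lemma for `F k + G k`. -/
theorem integral_le_of_tendsto_of_add_nonneg {α : Type*} [MeasurableSpace α] {μ : Measure α}
    {F G : ℕ → α → ℝ} {F₀ G₀ : α → ℝ} {E : ℝ}
    (hF : ∀ᵐ x ∂μ, Tendsto (fun k => F k x) atTop (𝓝 (F₀ x)))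
    (hG : ∀ᵐ x ∂μ, Tendsto (fun k => G k x) atTop (𝓝 (G₀ x)))
    (hFi : ∀ k, Integrable (F k) μ) (hGi : ∀ k, Integrable (G k) μ)
    (hF₀ : Integrable F₀ μ) (hG₀ : Integrable G₀ μ)
    (hnn : ∀ k, ∀ᵐ x ∂μ, 0 ≤ F k x + G k x)
    (hGint : ∀ k, ∫ x, G k x ∂μ ≤ ∫ x, G₀ x ∂μ) (hFint : ∀ k, ∫ x, F k x ∂μ ≤ E) :
    ∫ x, F₀ x ∂μ ≤ E := by
  have hle : ∀ k, ∫ x, (F k x + G k x) ∂μ ≤ E + ∫ x, G₀ x ∂μ := fun k => by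
    rw [integral_add (hFi k) (hGi k)]
    exact add_le_add (hFint k) (hGint k)
  have hEG : 0 ≤ E + ∫ x, G₀ x ∂μ :=
    (integral_nonneg_of_ae (hnn 0)).trans (hle 0)
  have hall : ∀ᵐ x ∂μ, ∀ k, 0 ≤ F k x + G k x := ae_all_iff.2 hnn
  have hnn₀ : 0 ≤ᵐ[μ] fun x => F₀ x + G₀ x := by
    filter_upwards [hF, hG, hall] with x h1 h2 h3
    exact ge_of_tendsto' (h1.add h2) h3
  have key : ∫⁻ x, ENNReal.ofReal (F₀ x + G₀ x) ∂μ ≤ ENNReal.ofReal (E + ∫ x, G₀ x ∂μ) := by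
    calc ∫⁻ x, ENNReal.ofReal (F₀ x + G₀ x) ∂μ
        = ∫⁻ x, liminf (fun k => ENNReal.ofReal (F k x + G k x)) atTop ∂μ := by
          refine lintegral_congr_ae ?_
          filter_upwards [hF, hG] with x h1 h2
          exact ((ENNReal.continuous_ofReal.tendsto _).comp (h1.add h2)).liminf_eq.symm
      _ ≤ liminf (fun k => ∫⁻ x, ENNReal.ofReal (F k x + G k x) ∂μ) atTop :=
          lintegral_liminf_le' fun k =>
            ((hFi k).add (hGi k)).aestronglyMeasurable.aemeasurable.ennreal_ofReal
      _ ≤ ENNReal.ofReal (E + ∫ x, G₀ x ∂μ) := by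
          refine (liminf_le_liminf (Eventually.of_forall fun k => ?_)).trans
            (liminf_const _).le
          exact (ofReal_integral_eq_lintegral_ofReal ((hFi k).add (hGi k)) (hnn k)).symm.trans_le
            (ENNReal.ofReal_le_ofReal (hle k))
  replace key := (ofReal_integral_eq_lintegral_ofReal (hF₀.add hG₀) hnn₀).trans_le key
  rw [ENNReal.ofReal_le_ofReal_iff hEG] at key
  have := integral_add hF₀ hG₀
  simp only [Pi.add_apply] at key
  linarith

/-- A Carathéodory function composed with measurable functions is measurable. -/
theorem IsCaratheodory.aemeasurable_comp {A : RSpace n → ℝ → RSpace n → RSpace n}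
    (hA : IsCaratheodory A) {u : RSpace n → ℝ} {g : RSpace n → RSpace n}
    (hu : AEMeasurable u volume) (hg : AEMeasurable g volume) :
    AEMeasurable (fun x => A x (u x) (g x)) volume := by
  let D : ℕ → ℝ × RSpace n := TopologicalSpace.denseSeq (ℝ × RSpace n)
  have hD : DenseRange D := TopologicalSpace.denseRange_denseSeq _
  -- Each A(·,z) is measurable only off a null set depending on z. A countable dense set of z yields
  -- one null set S; setting A to zero on S keeps continuity in z, which carries measurability from
  -- the dense set to all z.
  have hae : ∀ᵐ x ∂(volume : Measure (RSpace n)), ∀ k,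
      A x (D k).1 (D k).2 = (hA.aemeasurable (D k).1 (D k).2).mk _ x :=
    ae_all_iff.2 fun k => (hA.aemeasurable (D k).1 (D k).2).ae_eq_mk
  obtain ⟨S, hSsub, hSm, hSnull⟩ := exists_measurable_superset_of_null (ae_iff.1 hae)
  let B : ℝ × RSpace n → RSpace n → RSpace n := fun z => (Sᶜ).indicator fun x => A x z.1 z.2
  have hBD : ∀ k, Measurable (B (D k)) := fun k => by
    have : B (D k) = (Sᶜ).indicator ((hA.aemeasurable (D k).1 (D k).2).mk _) := by
      funext x
      by_cases hx : x ∈ S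
      · simp [B, hx]
      · have : ∀ k, A x (D k).1 (D k).2 = (hA.aemeasurable (D k).1 (D k).2).mk _ x := by
          by_contra h
          exact hx (hSsub h)
        simp only [B, Set.indicator, Set.mem_compl_iff, hx, not_false_eq_true, if_true, this k]
    rw [this]
    exact (hA.aemeasurable (D k).1 (D k).2).measurable_mk.indicator hSm.compl
  have hBc : ∀ x, Continuous fun z => B z x := fun x => by
    by_cases hx : x ∈ S
    · simpa [B, hx] using continuous_const
    · simpa [B, hx] using hA.continuous x
  have hBm : ∀ z, Measurable (B z) := fun z => by
    obtain ⟨w, hw, hwz⟩ := mem_closure_iff_seq_limit.1 (hD z)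
    choose j hj using hw
    refine measurable_of_tendsto_metrizable (f := fun k => B (w k)) (fun k => ?_)
      (tendsto_pi_nhds.2 fun x => ((hBc x).tendsto z).comp hwz)
    rw [← hj k]
    exact hBD _
  have hunc := measurable_uncurry_of_continuous_of_measurable hBc hBm
  have hcomp : AEMeasurable (fun x => Function.uncurry B ((u x, g x), x)) volume :=
    hunc.comp_aemeasurable ((hu.prodMk hg).prodMk aemeasurable_id)
  refine hcomp.congr ?_
  have : ∀ᵐ x ∂(volume : Measure (RSpace n)), x ∉ S := by
    rw [ae_iff]; simpa using hSnull
  filter_upwards [this] with x hx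
  simp [B, Function.uncurry, hx]

/-! ### Log-Hölder exponents and finite modulars. -/

theorem LogHolder.continuous {α : RSpace n → ℝ} (h : LogHolder α) : Continuous α := by
  obtain ⟨L, hL, h⟩ := h
  rw [continuous_iff_continuousAt]
  intro x
  rw [ContinuousAt, tendsto_iff_dist_tendsto_zero]
  -- At y = x the convention `1 / 0 = 0` makes the log-Hölder bound L instead of 0, so that point is
  -- treated separately.
  have hbound : ∀ y, dist (α y) (α x) ≤ if y = x then 0 else
      L / Real.log (Real.exp 1 + 1 / ‖y - x‖) := fun y => by
    split_ifs with hyx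
    · simp [hyx]
    · exact h y x
  have hlim : Tendsto (fun y => L / Real.log (Real.exp 1 + 1 / ‖y - x‖)) (𝓝[≠] x) (𝓝 0) := by
    refine Tendsto.div_atTop tendsto_const_nhds (Real.tendsto_log_atTop.comp
      (tendsto_atTop_add_const_left _ _ ?_))
    simp only [one_div]
    refine tendsto_inv_nhdsGT_zero.comp (tendsto_nhdsWithin_iff.2 ⟨?_, ?_⟩)
    · refine tendsto_nhdsWithin_of_tendsto_nhds ?_
      have : Continuous fun y => ‖y - x‖ := by fun_prop
      simpa using this.tendsto x
    · filter_upwards [self_mem_nhdsWithin] with y hy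
      exact norm_pos_iff.2 (sub_ne_zero.2 hy)
  refine squeeze_zero (fun _ => dist_nonneg) hbound ?_
  rw [← nhdsNE_sup_pure, tendsto_sup]
  refine ⟨hlim.congr' ?_, ?_⟩
  · filter_upwards [self_mem_nhdsWithin] with y hy
    exact (if_neg hy).symm
  · rw [tendsto_pure_left]
    intro s hs
    simpa using mem_of_mem_nhds hs

/-- A set of full Lebesgue measure is dense and the inequality is a closed condition. This makes the
essential bounds on the exponent hold everywhere. -/
theorem le_of_ae_le_of_continuous {p q : RSpace n → ℝ} (hp : Continuous p) (hq : Continuous q)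
    (h : ∀ᵐ x ∂(volume : Measure (RSpace n)), p x ≤ q x) (x : RSpace n) : p x ≤ q x := by
  have hcl : IsClosed {x | p x ≤ q x} := isClosed_le hp hq
  have := Measure.dense_of_ae h
  exact (hcl.closure_eq ▸ this x : x ∈ {x | p x ≤ q x})

theorem IsBoundedLogHolderExponent.continuous {p : RSpace n → ℝ}
    (hp : IsBoundedLogHolderExponent p) : Continuous p := by
  have h := hp.logHolder.continuous
  have h2 : Continuous fun x => (1 / p x)⁻¹ :=
    h.inv₀ fun x => (one_div_pos.2 (zero_lt_one.trans_le (hp.one_le x))).ne'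
  simpa using h2

theorem IsBoundedLogHolderExponent.exists_upper {p : RSpace n → ℝ}
    (hp : IsBoundedLogHolderExponent p) : ∃ P : ℝ, ∀ x, p x ≤ P := by
  obtain ⟨P, hP⟩ := hp.bounded
  exact ⟨P, le_of_ae_le_of_continuous hp.continuous continuous_const hP⟩

theorem IsBoundedLogHolderExponent.pMinus_le {p : RSpace n → ℝ}
    (hp : IsBoundedLogHolderExponent p) (x : RSpace n) : pMinus p ≤ p x := by
  refine le_of_ae_le_of_continuous continuous_const hp.continuous ?_ x
  exact ae_essInf_le ⟨1, eventually_map.2 (Eventually.of_forall hp.one_le)⟩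

theorem rpow_le_max_one_rpow {s p P : ℝ} (hs : 0 ≤ s) (hp : 0 ≤ p) (hP : p ≤ P) :
    s ^ p ≤ max 1 s ^ P :=
  (Real.rpow_le_rpow hs (le_max_right _ _) hp).trans
    (Real.rpow_le_rpow_of_exponent_le (le_max_left _ _) hP)

/-- For bounded exponents, a function in `L^{p(·)}` has a finite modular. -/
theorem MemVarLp.integrableOn_rpow {p : RSpace n → ℝ} (hpc : Continuous p) (hp1 : ∀ x, 1 ≤ p x)
    {P : ℝ} (hP : ∀ x, p x ≤ P) {g : RSpace n → RSpace n} {S : Set (RSpace n)}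
    (hg : MemVarLp p S g) : IntegrableOn (fun x => ‖g x‖ ^ p x) S := by
  obtain ⟨hm, μ, hμ, hfin⟩ := hg
  have hmeas : AEStronglyMeasurable (fun x => ‖g x‖ ^ p x) (volume.restrict S) :=
    (hm.norm.aemeasurable.pow hpc.measurable.aemeasurable).aestronglyMeasurable
  refine ⟨hmeas, ?_⟩
  have hle : ∀ x, ‖‖g x‖ ^ p x‖ₑ ≤
      ENNReal.ofReal (max 1 μ ^ P) * ‖μ⁻¹ • g x‖ₑ ^ p x := fun x => by
    have hp0 : 0 ≤ p x := zero_le_one.trans (hp1 x)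
    rw [← ofReal_norm (μ⁻¹ • g x), ENNReal.ofReal_rpow_of_nonneg (norm_nonneg _) hp0,
      ← ENNReal.ofReal_mul (by positivity), Real.enorm_eq_ofReal (by positivity)]
    refine ENNReal.ofReal_le_ofReal ?_
    have : ‖g x‖ = μ * ‖μ⁻¹ • g x‖ := by
      rw [norm_smul, Real.norm_of_nonneg (by positivity)]; field_simp
    rw [this, Real.mul_rpow hμ.le (norm_nonneg _)]
    gcongr
    exact rpow_le_max_one_rpow hμ.le hp0 (hP x)
  refine (lintegral_mono hle).trans_lt ?_
  rw [lintegral_const_mul' _ _ ENNReal.ofReal_ne_top]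
  exact ENNReal.mul_lt_top ENNReal.ofReal_lt_top hfin

/-! ### Mollification in variable exponent spaces. -/

/-- Mollification commutes with weak differentiation. -/
theorem IsWeakGradient.fderiv_convolution {u : RSpace n → ℝ} {g : RSpace n → RSpace n}
    (h : IsWeakGradient u g) {ρ : RSpace n → ℝ} (hρ : IsTestFunction ρ) (x v : RSpace n) :
    fderiv ℝ (ρ ⋆[lsmul ℝ ℝ, volume] u) x v
      = inner ℝ ((ρ ⋆[lsmul ℝ ℝ, volume] g) x) v := by
  have hρ1 : ContDiff ℝ 1 ρ := hρ.1.of_le (by norm_cast)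
  have hder := (hρ.2.hasFDerivAt_convolution_left (lsmul ℝ ℝ) hρ1 h.locallyIntegrable x).fderiv
  have hex1 : ConvolutionExistsAt (fderiv ℝ ρ) u x ((lsmul ℝ ℝ).precompL (RSpace n)) volume :=
    (hρ.2.fderiv ℝ).convolutionExists_left _ (hρ1.continuous_fderiv one_ne_zero)
      h.locallyIntegrable x
  have hex2 : ConvolutionExistsAt ρ g x (lsmul ℝ ℝ) volume :=
    hρ.2.convolutionExists_left _ hρ.1.continuous h.locallyIntegrable_grad x
  have hint1 := hex1.integrable_swap
  have hint2 := hex2.integrable_swap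
  have htest : IsTestFunction fun y => ρ (x - y) := by
    refine ⟨hρ.1.comp (contDiff_const.sub contDiff_id), ?_⟩
    exact hρ.2.comp_homeomorph (Homeomorph.subLeft x)
  have hgrad : ∀ y i, gradient (fun y => ρ (x - y)) y i
      = -(fderiv ℝ ρ (x - y) (EuclideanSpace.single i 1)) := fun y i => by
    have h1 : gradient (fun y => ρ (x - y)) y i
        = inner ℝ (gradient (fun y => ρ (x - y)) y) (EuclideanSpace.single i 1) := by
      rw [EuclideanSpace.inner_single_right]; simp
    rw [h1, inner_gradient_left]
    have h2 : HasFDerivAt (fun y => ρ (x - y))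
        ((fderiv ℝ ρ (x - y)).comp (-(ContinuousLinearMap.id ℝ (RSpace n)))) y :=
      ((hρ1.differentiable one_ne_zero) (x - y)).hasFDerivAt.comp y
        ((hasFDerivAt_id y).const_sub x)
    rw [h2.fderiv]
    simp
  have hcoord : ∀ i, fderiv ℝ (ρ ⋆[lsmul ℝ ℝ, volume] u) x (EuclideanSpace.single i 1)
      = (ρ ⋆[lsmul ℝ ℝ, volume] g) x i := fun i => by
    rw [hder, convolution_eq_swap, ContinuousLinearMap.integral_apply hint1,
      convolution_eq_swap]
    have h3 := (EuclideanSpace.proj i : RSpace n →L[ℝ] ℝ).integral_comp_comm hint2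
    refine Eq.trans ?_ h3
    have h4 := h.integral_eq _ htest i
    simp only [hgrad] at h4
    simp only [mul_neg, integral_neg, neg_inj] at h4
    convert h4 using 1
    · refine integral_congr_ae (Eventually.of_forall fun t => ?_)
      simp [ContinuousLinearMap.precompL_apply, mul_comm]
    · refine integral_congr_ae (Eventually.of_forall fun t => ?_)
      simp [mul_comm]
  have hlin : fderiv ℝ (ρ ⋆[lsmul ℝ ℝ, volume] u) x
      = innerSL ℝ ((ρ ⋆[lsmul ℝ ℝ, volume] g) x) := by
    refine ContinuousLinearMap.coe_injective
      ((EuclideanSpace.basisFun (Fin n) ℝ).toBasis.ext fun i => ?_)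
    simp [hcoord, EuclideanSpace.inner_single_right]
  rw [hlin]; simp

/-- Mollifications of a function in `L^{p(·)}` are controlled pointwise by mollifications of its
modular, if `p` is log-Hölder continuous. -/
theorem norm_convolution_rpow_le {p : RSpace n → ℝ} {P L : ℝ} (hp1 : ∀ x, 1 ≤ p x)
    (hP : ∀ x, p x ≤ P) (hL : 0 < L)
    (hlog : ∀ x y, |1 / p x - 1 / p y| ≤ L / Real.log (Real.exp 1 + 1 / ‖x - y‖))
    {ρ : RSpace n → ℝ} (hρ : Continuous ρ) (hρc : HasCompactSupport ρ) (hρ0 : ∀ x, 0 ≤ ρ x)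
    (hρ1 : ∫ x, ρ x = 1) {ε : ℝ} (hε : 0 < ε)
    (hρs : ∀ x, ρ x ≠ 0 → ‖x‖ < ε) {B : ℝ} (hρB : ∀ x, ρ x ≤ B / ε ^ n)
    {g : RSpace n → RSpace n} {H : RSpace n → ℝ} (hH : Integrable H) (hH0 : ∀ x, 0 ≤ H x)
    (x : RSpace n) (hgH : ∀ y, ‖x - y‖ < ε → 1 + ‖g y‖ ^ p y ≤ H y) :
    ‖(ρ ⋆[lsmul ℝ ℝ, volume] g) x‖ ^ p x ≤
      2 ^ P * Real.exp (P * L * (Real.log (max 1 (B * ∫ y, H y)) + n))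
        * (ρ ⋆[lsmul ℝ ℝ, volume] H) x := by
  set I : ℝ := (ρ ⋆[lsmul ℝ ℝ, volume] H) x with hI
  have hp0 : ∀ y, 0 < p y := fun y => zero_lt_one.trans_le (hp1 y)
  have hP0 : 0 ≤ P := (hp0 x).le.trans (hP x)
  have hIeq : I = ∫ y, ρ (x - y) * H y := by
    rw [hI, convolution_eq_swap]; simp
  have hHint : Integrable fun y => ρ (x - y) * H y := by
    have := (hρc.convolutionExists_left (lsmul ℝ ℝ) hρ hH.locallyIntegrable x).integrable_swap
    simpa using this
  have hρint : Integrable fun y => ρ (x - y) :=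
    (hρ.integrable_of_hasCompactSupport hρc).comp_sub_left x
  have hρx1 : ∫ y, ρ (x - y) = 1 := by rw [integral_sub_left_eq_self ρ volume x, hρ1]
  -- The summand 1 in the lower bound for H is there for this: powers of I increase with the
  -- exponent, and log I ≥ 0.
  have hI1 : 1 ≤ I := by
    rw [hIeq, ← hρx1]
    refine integral_mono hρint hHint fun y => ?_
    by_cases hy : ρ (x - y) = 0
    · simp [hy]
    · have := hgH y (hρs _ hy)
      have h2 : 0 ≤ ‖g y‖ ^ p y := by positivity
      exact le_mul_of_one_le_right (hρ0 _) (by linarith)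
  have hI0 : 0 < I := zero_lt_one.trans_le hI1
  have hIB : I ≤ (B * ∫ y, H y) / ε ^ n := by
    rw [hIeq, mul_div_right_comm, ← integral_const_mul]
    refine integral_mono hHint (hH.const_mul _) fun y => ?_
    exact mul_le_mul_of_nonneg_right (hρB _) (hH0 y)
  have hlog1 : 1 ≤ Real.log (Real.exp 1 + 1 / ε) := by
    rw [Real.le_log_iff_exp_le (by positivity)]
    have : 0 ≤ 1 / ε := by positivity
    linarith
  set δ : ℝ := L / Real.log (Real.exp 1 + 1 / ε) with hδ
  have hδ0 : 0 ≤ δ := by positivity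
  have hpy : ∀ y, ‖x - y‖ < ε → 1 / p y ≤ 1 / p x + δ := fun y hy => by
    rcases eq_or_ne x y with rfl | hxy
    · linarith
    have h1 := (abs_le.1 (hlog x y)).1
    have hpos : 0 < ‖x - y‖ := norm_pos_iff.2 (sub_ne_zero.2 hxy)
    have h2 : L / Real.log (Real.exp 1 + 1 / ‖x - y‖) ≤ δ := by
      rw [hδ]
      gcongr
    linarith
  -- The level is chosen so that lam^p(y) ≥ I for every y in the ε-ball, δ bounding the oscillation
  -- of 1/p from x. Where |g(y)| > lam, then |g|/lam ≤ (|g|/lam)^p(y) ≤ H(y)/I; averaging against ρ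
  -- gives |ρ*g| ≤ 2 lam.
  set lam : ℝ := I ^ (1 / p x + δ) with hlam
  have hlam0 : 0 < lam := by positivity
  have hpt : ∀ y, ‖x - y‖ < ε → ‖g y‖ ≤ lam * (1 + I⁻¹ * H y) := fun y hy => by
    have hH' := hgH y hy
    rcases le_or_gt ‖g y‖ lam with hle | hgt
    · refine hle.trans (le_mul_of_one_le_right hlam0.le ?_)
      have : 0 ≤ I⁻¹ * H y := mul_nonneg (by positivity) (hH0 y)
      linarith
    · have h1 : 1 ≤ ‖g y‖ / lam := (one_le_div hlam0).2 hgt.le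
      have h2 : ‖g y‖ / lam ≤ (‖g y‖ / lam) ^ p y := by
        simpa using Real.rpow_le_rpow_of_exponent_le h1 (hp1 y)
      have h3 : I ≤ lam ^ p y := by
        rw [hlam, ← Real.rpow_mul hI0.le]
        have : 1 ≤ (1 / p x + δ) * p y := by
          have := mul_le_mul_of_nonneg_right (hpy y hy) (hp0 y).le
          rwa [one_div_mul_cancel (hp0 y).ne'] at this
        simpa using Real.rpow_le_rpow_of_exponent_le hI1 this
      have h4 : (‖g y‖ / lam) ^ p y ≤ I⁻¹ * H y := by
        rw [Real.div_rpow (norm_nonneg _) hlam0.le, div_eq_inv_mul]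
        gcongr
        linarith
      calc ‖g y‖ = lam * (‖g y‖ / lam) := by field_simp
        _ ≤ lam * (1 + I⁻¹ * H y) := by gcongr; linarith
  have hnorm : ‖(ρ ⋆[lsmul ℝ ℝ, volume] g) x‖ ≤ 2 * lam := by
    rw [convolution_eq_swap]
    have hb : Integrable fun y => lam * (ρ (x - y) + I⁻¹ * (ρ (x - y) * H y)) :=
      (hρint.add (hHint.const_mul _)).const_mul _
    refine (norm_integral_le_of_norm_le hb (Eventually.of_forall fun y => ?_)).trans_eq ?_
    · simp only [ContinuousLinearMap.lsmul_apply, norm_smul, Real.norm_of_nonneg (hρ0 _)]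
      by_cases hy : ρ (x - y) = 0
      · simp [hy]
      · have := mul_le_mul_of_nonneg_left (hpt y (hρs _ hy)) (hρ0 (x - y))
        linarith
    · rw [integral_const_mul, integral_add hρint (hHint.const_mul _), integral_const_mul,
        ← hIeq, hρx1, inv_mul_cancel₀ hI0.ne']
      ring
  have hlogI : Real.log I ≤ Real.log (max 1 (B * ∫ y, H y)) + n * Real.log (1 / ε) := by
    have h1 : I ≤ max 1 (B * ∫ y, H y) * (1 / ε) ^ n := by
      refine hIB.trans ?_
      rw [div_eq_mul_one_div, one_div_pow]
      gcongr
      exact le_max_right _ _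
    have h2 := Real.log_le_log hI0 h1
    rwa [Real.log_mul (by positivity) (by positivity), Real.log_pow] at h2
  -- Here log-Hölder continuity pays off: I grows at most like ε^(-n) while δ log(1/ε) ≤ L, so the
  -- error factor I^(p(x)δ) is bounded independently of ε.
  have hδlog : δ * Real.log I ≤ L * (Real.log (max 1 (B * ∫ y, H y)) + n) := by
    have h1 : δ ≤ L := div_le_self hL.le hlog1
    have h2 : δ * Real.log (1 / ε) ≤ L := by
      rw [hδ, div_mul_eq_mul_div, div_le_iff₀ (by linarith)]
      gcongr
      linarith [Real.exp_pos 1]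
    have h3 : 0 ≤ Real.log (max 1 (B * ∫ y, H y)) := Real.log_nonneg (le_max_left _ _)
    calc δ * Real.log I
        ≤ δ * (Real.log (max 1 (B * ∫ y, H y)) + n * Real.log (1 / ε)) := by gcongr
      _ = δ * Real.log (max 1 (B * ∫ y, H y)) + n * (δ * Real.log (1 / ε)) := by ring
      _ ≤ L * Real.log (max 1 (B * ∫ y, H y)) + n * L := by gcongr
      _ = _ := by ring
  have hpow : lam ^ p x ≤ Real.exp (P * L * (Real.log (max 1 (B * ∫ y, H y)) + n)) * I := by
    have h0 : (1 / p x + δ) * p x = p x * δ + 1 := by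
      have := (hp0 x).ne'
      field_simp
      ring
    rw [hlam, ← Real.rpow_mul hI0.le, h0, Real.rpow_add hI0, Real.rpow_one,
      Real.rpow_def_of_pos hI0]
    refine mul_le_mul_of_nonneg_right (Real.exp_le_exp.2 ?_) hI0.le
    calc Real.log I * (p x * δ) = p x * (δ * Real.log I) := by ring
      _ ≤ P * (L * (Real.log (max 1 (B * ∫ y, H y)) + n)) := by
          refine mul_le_mul (hP x) hδlog ?_ hP0
          exact mul_nonneg hδ0 (Real.log_nonneg hI1)
      _ = _ := by ring
  calc ‖(ρ ⋆[lsmul ℝ ℝ, volume] g) x‖ ^ p x ≤ (2 * lam) ^ p x :=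
        Real.rpow_le_rpow (norm_nonneg _) hnorm (hp0 x).le
    _ = 2 ^ p x * lam ^ p x := Real.mul_rpow two_pos.le hlam0.le
    _ ≤ 2 ^ P * (Real.exp (P * L * (Real.log (max 1 (B * ∫ y, H y)) + n)) * I) := by
        gcongr
        · exact one_le_two
        · exact hP x
    _ = _ := by ring

/-- A sequence of bump functions concentrating at the origin. -/
def bumpSeq (n k : ℕ) : ContDiffBump (0 : RSpace n) where
  rIn := 1 / (2 * ((k : ℝ) + 1))
  rOut := 1 / ((k : ℝ) + 1)
  rIn_pos := by positivity
  rIn_lt_rOut := by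
    have : (0 : ℝ) < k + 1 := by positivity
    exact one_div_lt_one_div_of_lt this (by linarith)

/-- The standard mollifiers. -/
def mollifier (n k : ℕ) : RSpace n → ℝ := (bumpSeq n k).normed volume

theorem isTestFunction_mollifier (k : ℕ) : IsTestFunction (mollifier n k) :=
  ⟨(bumpSeq n k).contDiff_normed, (bumpSeq n k).hasCompactSupport_normed⟩

theorem mollifier_nonneg (k : ℕ) (x : RSpace n) : 0 ≤ mollifier n k x :=
  (bumpSeq n k).nonneg_normed x

theorem integral_mollifier (k : ℕ) : ∫ x, mollifier n k x = 1 := (bumpSeq n k).integral_normed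

theorem norm_lt_of_mollifier_ne_zero {k : ℕ} {x : RSpace n} (h : mollifier n k x ≠ 0) :
    ‖x‖ < 1 / ((k : ℝ) + 1) := by
  have : x ∈ Function.support ((bumpSeq n k).normed volume) := h
  rw [ContDiffBump.support_normed_eq] at this
  simpa [bumpSeq] using this

/-- The two radii have fixed ratio 2, which costs a factor 2^n over the inverse volume of the
support ball. The numerator does not depend on k, as `norm_convolution_rpow_le` requires for a
uniform constant. -/
theorem mollifier_le (k : ℕ) (x : RSpace n) :
    mollifier n k x ≤ (2 ^ n / (volume : Measure (RSpace n)).real (Metric.closedBall 0 1))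
      / (1 / ((k : ℝ) + 1)) ^ n := by
  have h := (bumpSeq n k).normed_le_div_measure_closedBall_rOut volume 2
    (by simp [bumpSeq]; field_simp; rfl) x
  refine h.trans_eq ?_
  rw [Measure.real, Measure.addHaar_closedBall' _ _ (bumpSeq n k).rOut_pos.le, ENNReal.toReal_mul,
    ENNReal.toReal_ofReal (pow_nonneg (bumpSeq n k).rOut_pos.le _), finrank_euclideanSpace_fin,
    mul_comm, ← div_div]
  rfl

theorem ae_tendsto_mollify {F : Type*} [NormedAddCommGroup F] [NormedSpace ℝ F] [CompleteSpace F]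
    {g : RSpace n → F} (hg : LocallyIntegrable g) : ∀ᵐ x ∂(volume : Measure (RSpace n)),
      Tendsto (fun k => (mollifier n k ⋆[lsmul ℝ ℝ, volume] g) x) atTop (𝓝 (g x)) := by
  refine ContDiffBump.ae_convolution_tendsto_right_of_locallyIntegrable (φ := bumpSeq n) (K := 2)
    tendsto_one_div_add_atTop_nhds_zero_nat (Eventually.of_forall fun k => ?_) hg
  simp [bumpSeq]; field_simp; rfl

/-! ### Integrability, absorption and cutoffs. -/

theorem integrable_clm_apply {h : RSpace n → RSpace n} (hh : LocallyIntegrable h)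
    {T : RSpace n → (RSpace n →L[ℝ] ℝ)} (hT : Continuous T) (hTc : HasCompactSupport T) :
    Integrable fun x => T x (h x) := by
  have h1 : Integrable fun x => ‖T x‖ • ‖h x‖ :=
    LocallyIntegrable.integrable_smul_left_of_hasCompactSupport
      (f := fun x => ‖h x‖) (fun x => (hh x).norm) hT.norm hTc.norm
  refine h1.mono' ?_ (Eventually.of_forall fun x => (T x).le_opNorm (h x))
  exact (ContinuousLinearMap.id ℝ (RSpace n →L[ℝ] ℝ)).aestronglyMeasurable_comp₂
    hT.aestronglyMeasurable hh.aestronglyMeasurable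

theorem integrable_mul_inner {h w : RSpace n → RSpace n} (hh : LocallyIntegrable h)
    (hw : Continuous w) {ψ : RSpace n → ℝ} (hψ : Continuous ψ) (hψc : HasCompactSupport ψ) :
    Integrable fun x => ψ x * inner ℝ (h x) (w x) := by
  have := integrable_clm_apply hh (T := fun x => ψ x • innerSL ℝ (w x))
    (hψ.smul ((innerSL ℝ).continuous.comp hw)) hψc.smul_right
  refine this.congr (Eventually.of_forall fun x => ?_)
  simp [real_inner_comm]

/-- The product is at most the p-th power of the larger of s and t. -/
theorem rpow_sub_one_mul_le {s t p : ℝ} (hs : 0 ≤ s) (ht : 0 ≤ t) (hp : 1 ≤ p) :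
    s ^ (p - 1) * t ≤ s ^ p + t ^ p := by
  have key : ∀ m : ℝ, 0 ≤ m → m ^ (p - 1) * m = m ^ p := fun m hm => by
    rcases hm.eq_or_lt with rfl | hm
    · rw [mul_zero, Real.zero_rpow (by linarith)]
    · rw [← Real.rpow_add_one hm.ne', sub_add_cancel]
  rcases le_total s t with h | h
  · have h1 : s ^ (p - 1) * t ≤ t ^ (p - 1) * t := by gcongr
    rw [key t ht] at h1
    have : 0 ≤ s ^ p := by positivity
    linarith
  · have h1 : s ^ (p - 1) * t ≤ s ^ (p - 1) * s := by gcongr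
    rw [key s hs] at h1
    have : 0 ≤ t ^ p := by positivity
    linarith

/-- Absorption of the right-hand side of a Caccioppoli inequality. -/
theorem mul_rpow_sub_one_le {κ a s η σ p P : ℝ} {N : ℕ} (hκ : 0 < κ) (ha : 0 < a) (hs : 0 ≤ s)
    (hη : 0 ≤ η) (hη1 : η ≤ 1) (hσ : 0 ≤ σ) (hp : 1 < p) (hpP : p ≤ P) (hPN : P ≤ N) :
    κ * (s ^ (p - 1) * η ^ (N - 1) * σ) ≤
      a * (η ^ N * s ^ p) + κ * max 1 (κ / a) ^ P * σ ^ p := by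
  have hN : 1 ≤ N := by
    have : (1 : ℝ) ≤ N := by linarith
    exact_mod_cast this
  have hC : 0 ≤ κ * max 1 (κ / a) ^ P * σ ^ p := by positivity
  rcases hη.eq_or_lt with rfl | hη
  · have hN1 : N ≠ 1 := by
      rintro rfl
      norm_num at hPN
      linarith
    rw [zero_pow (by omega)]
    have : 0 ≤ a * (0 ^ N * s ^ p) := by positivity
    linarith
  rcases hs.eq_or_lt with rfl | hs
  · rw [Real.zero_rpow (by linarith)]
    have : 0 ≤ a * (η ^ N * (0 : ℝ) ^ p) := by positivity
    linarith
  have hNN : η ^ N = η ^ (N - 1) * η := (pow_sub_one_mul (by omega) η).symm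
  have hsp : s ^ p = s ^ (p - 1) * s := by rw [← Real.rpow_add_one hs.ne', sub_add_cancel]
  -- If κσ ≤ asη, the left side is absorbed by the first term. Otherwise sη < (κ/a)σ, and N ≥ p
  -- gives η^(N-1) ≤ η^(p-1), so s^(p-1)η^(N-1) is controlled by σ^(p-1).
  rcases le_or_gt (κ * σ) (a * (s * η)) with h | h
  · have h1 : s ^ (p - 1) * η ^ (N - 1) * (κ * σ) ≤ s ^ (p - 1) * η ^ (N - 1) * (a * (s * η)) := by
      gcongr
    rw [hNN, hsp]
    linarith
  · have hσ0 : 0 < σ := by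
      refine hσ.lt_of_ne ?_
      rintro rfl
      have : 0 < a * (s * η) := by positivity
      linarith
    have h1 : s * η ≤ κ / a * σ := by
      rw [div_mul_eq_mul_div, le_div_iff₀ ha]; linarith
    have h2 : η ^ (N - 1) ≤ η ^ (p - 1) := by
      rw [← Real.rpow_natCast, Nat.cast_sub hN]
      refine Real.rpow_le_rpow_of_exponent_ge hη hη1 ?_
      push_cast; linarith
    have h3 : s ^ (p - 1) * η ^ (N - 1) ≤ max 1 (κ / a) ^ P * σ ^ (p - 1) := by
      calc s ^ (p - 1) * η ^ (N - 1) ≤ s ^ (p - 1) * η ^ (p - 1) := by gcongr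
        _ = (s * η) ^ (p - 1) := (Real.mul_rpow hs.le hη.le).symm
        _ ≤ (κ / a * σ) ^ (p - 1) := by gcongr
        _ = (κ / a) ^ (p - 1) * σ ^ (p - 1) := Real.mul_rpow (by positivity) hσ
        _ ≤ _ := by
          gcongr
          exact rpow_le_max_one_rpow (by positivity) (by linarith) (by linarith)
    have h4 : σ ^ p = σ ^ (p - 1) * σ := by rw [← Real.rpow_add_one hσ0.ne', sub_add_cancel]
    have h5 : κ * (s ^ (p - 1) * η ^ (N - 1) * σ) ≤
        κ * (max 1 (κ / a) ^ P * σ ^ (p - 1) * σ) := by gcongr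
    have h6 : 0 ≤ a * (η ^ N * s ^ p) := by positivity
    rw [h4]
    linarith

/-- All cutoffs are dilates of a single bump, so D does not depend on R. -/
theorem exists_cutoff (n : ℕ) : ∃ D : ℝ, 0 < D ∧ ∀ R : ℝ, 0 < R → ∃ η : RSpace n → ℝ,
    IsTestFunction η ∧ (∀ x, 0 ≤ η x) ∧ (∀ x, η x ≤ 1) ∧ (∀ x, ‖x‖ ≤ R → η x = 1) ∧
    (∀ x, ‖fderiv ℝ η x‖ ≤ D / R) ∧ ∀ x, 2 * R < ‖x‖ → fderiv ℝ η x = 0 := by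
  let φ : ContDiffBump (0 : RSpace n) := ⟨1, 2, one_pos, one_lt_two⟩
  have hφ : ContDiff ℝ ∞ φ := φ.contDiff
  have hφ1 : ContDiff ℝ 1 φ := hφ.of_le (by norm_cast)
  obtain ⟨D, hD⟩ := (φ.hasCompactSupport.fderiv ℝ).exists_bound_of_continuous
    (hφ1.continuous_fderiv one_ne_zero)
  refine ⟨max 1 D, by positivity, fun R hR => ⟨fun x => φ (R⁻¹ • x), ⟨?_, ?_⟩, fun x => φ.nonneg,
    fun x => φ.le_one, fun x hx => ?_, fun x => ?_, fun x hx => ?_⟩⟩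
  · exact hφ.comp (contDiff_const_smul R⁻¹)
  · exact φ.hasCompactSupport.comp_homeomorph (Homeomorph.smulOfNeZero R⁻¹ (inv_ne_zero hR.ne'))
  · refine φ.one_of_mem_closedBall ?_
    rw [mem_closedBall_zero_iff, norm_smul, norm_inv, Real.norm_of_nonneg hR.le]
    exact (inv_mul_le_one₀ hR).2 hx
  · have h2 : HasFDerivAt (fun x => φ (R⁻¹ • x))
        ((fderiv ℝ φ (R⁻¹ • x)).comp (R⁻¹ • ContinuousLinearMap.id ℝ (RSpace n))) x :=
      ((hφ1.differentiable one_ne_zero) (R⁻¹ • x)).hasFDerivAt.comp x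
        ((hasFDerivAt_id x).const_smul R⁻¹)
    rw [h2.fderiv, ContinuousLinearMap.comp_smul, norm_smul, norm_inv, Real.norm_of_nonneg hR.le,
      ContinuousLinearMap.comp_id, div_eq_inv_mul]
    gcongr
    exact (hD _).trans (le_max_right _ _)
  · have hev : (fun x => φ (R⁻¹ • x)) =ᶠ[𝓝 x] fun _ => 0 := by
      have : ∀ᶠ y in 𝓝 x, 2 * R < ‖y‖ := continuous_norm.continuousAt.eventually_const_lt hx
      filter_upwards [this] with y hy
      refine φ.zero_of_le_dist ?_
      rw [dist_zero_right, norm_smul, norm_inv, Real.norm_of_nonneg hR.le, ← div_eq_inv_mul,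
        le_div_iff₀ hR]
      exact hy.le
    rw [hev.fderiv_eq]
    simp

/-! ### Testing with mollified solutions. -/

/-- Passage to the limit in an integral inequality for mollified gradients. -/
theorem integral_mul_inner_le_of_mollify {p : RSpace n → ℝ} {P L b : ℝ}
    (hp1 : ∀ x, 1 ≤ p x) (hP : ∀ x, p x ≤ P) (hL : 0 < L)
    (hlog : ∀ x y, |1 / p x - 1 / p y| ≤ L / Real.log (Real.exp 1 + 1 / ‖x - y‖))
    {g h : RSpace n → RSpace n} (hg : LocallyIntegrable g)
    (hgp : ∀ K : Set (RSpace n), IsCompact K → IntegrableOn (fun x => ‖g x‖ ^ p x) K)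
    (hh : LocallyIntegrable h) (hb : 0 ≤ b) (hhg : ∀ x, ‖h x‖ ≤ b * ‖g x‖ ^ (p x - 1))
    {ψ : RSpace n → ℝ} (hψ : Continuous ψ) (hψc : HasCompactSupport ψ) (hψ0 : ∀ x, 0 ≤ ψ x)
    (hψ1 : ∀ x, ψ x ≤ 1) {E : ℝ}
    (hE : ∀ k, ∫ x, ψ x * inner ℝ (h x) ((mollifier n k ⋆[lsmul ℝ ℝ, volume] g) x) ≤ E) :
    ∫ x, ψ x * inner ℝ (h x) (g x) ≤ E := by
  obtain ⟨R, hR⟩ := hψc.isCompact.isBounded.subset_closedBall (0 : RSpace n)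
  have hψR : ∀ x, ψ x ≠ 0 → ‖x‖ ≤ R := fun x hx => by
    simpa using hR (subset_tsupport _ hx)
  set K := Metric.closedBall (0 : RSpace n) (R + 1) with hK
  -- The mollifiers have radius at most 1, so over the support of ψ they only see g within radius R
  -- + 1.
  let H : RSpace n → ℝ := K.indicator fun x => 1 + ‖g x‖ ^ p x
  have hKc : IsCompact K := isCompact_closedBall _ _
  have hHi : Integrable H := by
    refine (integrable_indicator_iff hKc.isClosed.measurableSet).2 ?_
    exact (integrableOn_const hKc.measure_lt_top.ne).add (hgp K hKc)
  have hH0 : ∀ x, 0 ≤ H x := fun x => Set.indicator_nonneg (fun y _ => by positivity) x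
  have hHK : ∀ x, ‖x‖ ≤ R + 1 → H x = 1 + ‖g x‖ ^ p x := fun x hx =>
    Set.indicator_of_mem (by simpa [hK] using hx) _
  set B : ℝ := 2 ^ n / (volume : Measure (RSpace n)).real (Metric.closedBall 0 1)
  set C : ℝ := 2 ^ P * Real.exp (P * L * (Real.log (max 1 (B * ∫ y, H y)) + n)) with hC
  have hC0 : 0 ≤ C := by positivity
  have hmt := fun k => isTestFunction_mollifier (n := n) k
  have hmi : ∀ k, Integrable (mollifier n k) := fun k =>
    (hmt k).1.continuous.integrable_of_hasCompactSupport (hmt k).2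
  have hgk : ∀ k x, ‖x‖ ≤ R → ‖(mollifier n k ⋆[lsmul ℝ ℝ, volume] g) x‖ ^ p x
      ≤ C * (mollifier n k ⋆[lsmul ℝ ℝ, volume] H) x := fun k x hx => by
    refine norm_convolution_rpow_le hp1 hP hL hlog (hmt k).1.continuous (hmt k).2
      (mollifier_nonneg k) (integral_mollifier k) (ε := 1 / ((k : ℝ) + 1)) (by positivity)
      (fun x hx => norm_lt_of_mollifier_ne_zero hx) (mollifier_le k) hHi hH0 x fun y hy => ?_
    refine (hHK y ?_).ge
    have h1 : 1 / ((k : ℝ) + 1) ≤ 1 := by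
      rw [div_le_one (by positivity)]; linarith [(Nat.cast_nonneg k : (0 : ℝ) ≤ k)]
    have h2 := norm_sub_norm_le y x
    rw [norm_sub_rev] at h2
    linarith
  have hHk0 : ∀ k x, 0 ≤ (mollifier n k ⋆[lsmul ℝ ℝ, volume] H) x := fun k x =>
    integral_nonneg fun t => mul_nonneg (mollifier_nonneg k t) (hH0 _)
  have hpt : ∀ x, ‖x‖ ≤ R → ∀ w : RSpace n, ‖h x‖ * ‖w‖ ≤ b * (H x + ‖w‖ ^ p x) :=
    fun x hx w => by
      rw [hHK x (by linarith)]
      have h1 := rpow_sub_one_mul_le (norm_nonneg (g x)) (norm_nonneg w) (hp1 x)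
      calc ‖h x‖ * ‖w‖ ≤ b * ‖g x‖ ^ (p x - 1) * ‖w‖ := by gcongr; exact hhg x
        _ = b * (‖g x‖ ^ (p x - 1) * ‖w‖) := by ring
        _ ≤ _ := by gcongr; linarith
  have hprod : ∀ x, ∀ w : RSpace n, |ψ x * inner ℝ (h x) w| ≤ ‖h x‖ * ‖w‖ := fun x w => by
    rw [abs_mul, abs_of_nonneg (hψ0 x)]
    calc ψ x * |inner ℝ (h x) w| ≤ 1 * (‖h x‖ * ‖w‖) := by
          gcongr
          · exact hψ1 x
          · exact abs_real_inner_le_norm _ _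
      _ = _ := one_mul _
  have hgkc : ∀ k, Continuous (mollifier n k ⋆[lsmul ℝ ℝ, volume] g) := fun k =>
    (hmt k).2.continuous_convolution_left _ (hmt k).1.continuous hg
  have hHki : ∀ k, Integrable (mollifier n k ⋆[lsmul ℝ ℝ, volume] H) := fun k =>
    (hmi k).integrable_convolution _ hHi
  -- G is a moving majorant of -F, since |h||w| ≤ b(H + |w|^p) and |w|^p ≤ C ρ_k*H for w = ρ_k*g.
  -- Mollification preserves the integral of H, so each G k has the same integral as G₀.
  refine integral_le_of_tendsto_of_add_nonneg
    (F := fun k x => ψ x * inner ℝ (h x) ((mollifier n k ⋆[lsmul ℝ ℝ, volume] g) x))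
    (G := fun k x => b * (H x + C * (mollifier n k ⋆[lsmul ℝ ℝ, volume] H) x))
    (G₀ := fun x => b * (H x + C * H x)) ?_ ?_ ?_ ?_ ?_ ?_ ?_ ?_ hE
  · filter_upwards [ae_tendsto_mollify hg] with x hx
    exact ((tendsto_const_nhds (x := h x)).inner hx).const_mul (ψ x)
  · filter_upwards [ae_tendsto_mollify hHi.locallyIntegrable] with x hx
    exact ((hx.const_mul C).const_add (H x)).const_mul b
  · exact fun k => integrable_mul_inner hh (hgkc k) hψ hψc
  · exact fun k => (hHi.add ((hHki k).const_mul C)).const_mul b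
  · refine ((hHi.add hHi).const_mul b).mono' ?_ (Eventually.of_forall fun x => ?_)
    · exact hψ.aestronglyMeasurable.mul (hh.aestronglyMeasurable.inner hg.aestronglyMeasurable)
    · by_cases hx : ψ x = 0
      · have := hH0 x
        simp only [hx, zero_mul, norm_zero, Pi.add_apply]
        positivity
      · refine (hprod x _).trans ((hpt x (hψR x hx) _).trans ?_)
        simp only [Pi.add_apply]
        gcongr
        rw [hHK x (by linarith [hψR x hx])]
        linarith
  · exact (hHi.add (hHi.const_mul C)).const_mul b
  · refine fun k => Eventually.of_forall fun x => ?_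
    by_cases hx : ψ x = 0
    · have h1 := hH0 x
      have h2 := hHk0 k x
      simp only [hx, zero_mul, zero_add]
      positivity
    · have h1 := (abs_le.1 ((hprod x _).trans (hpt x (hψR x hx)
        ((mollifier n k ⋆[lsmul ℝ ℝ, volume] g) x)))).1
      have h2 := mul_le_mul_of_nonneg_left (hgk k x (hψR x hx)) hb
      linarith
  · intro k
    rw [integral_const_mul, integral_const_mul, integral_add hHi ((hHki k).const_mul C),
      integral_add hHi (hHi.const_mul C), integral_const_mul, integral_const_mul,
      integral_convolution (lsmul ℝ ℝ) (hmi k) hHi, integral_mollifier]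
    simp

theorem abs_mollify_le {u : RSpace n → ℝ} {M : ℝ}
    (hM : ∀ᵐ x ∂(volume : Measure (RSpace n)), |u x| ≤ M) (k : ℕ) (x : RSpace n) :
    |(mollifier n k ⋆[lsmul ℝ ℝ, volume] u) x| ≤ M := by
  have ht := isTestFunction_mollifier (n := n) k
  have hint : Integrable fun y => mollifier n k (x - y) :=
    (ht.1.continuous.integrable_of_hasCompactSupport ht.2).comp_sub_left x
  rw [convolution_eq_swap, ← Real.norm_eq_abs]
  refine (norm_integral_le_of_norm_le (hint.mul_const M) ?_).trans_eq ?_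
  · filter_upwards [hM] with y hy
    rw [ContinuousLinearMap.lsmul_apply, norm_smul, Real.norm_of_nonneg (mollifier_nonneg k _)]
    exact mul_le_mul_of_nonneg_left hy (mollifier_nonneg k _)
  · rw [integral_mul_const, integral_sub_left_eq_self (mollifier n k) volume x,
      integral_mollifier, one_mul]

/-- The inequality obtained by testing a bounded subsolution of `div h ≥ 0`, where `h` is
controlled by the gradient `g` of `u`, with `(u + M) ψ`. -/
theorem integral_mul_inner_le_of_bounded {p : RSpace n → ℝ} {P L b M : ℝ}
    (hp1 : ∀ x, 1 ≤ p x) (hP : ∀ x, p x ≤ P) (hL : 0 < L)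
    (hlog : ∀ x y, |1 / p x - 1 / p y| ≤ L / Real.log (Real.exp 1 + 1 / ‖x - y‖))
    {u : RSpace n → ℝ} {g h : RSpace n → RSpace n} (hug : IsWeakGradient u g)
    (hgp : ∀ K : Set (RSpace n), IsCompact K → IntegrableOn (fun x => ‖g x‖ ^ p x) K)
    (hh : LocallyIntegrable h) (hb : 0 ≤ b) (hhg : ∀ x, ‖h x‖ ≤ b * ‖g x‖ ^ (p x - 1))
    (hM : ∀ᵐ x ∂(volume : Measure (RSpace n)), |u x| ≤ M)
    (hsub : ∀ φ : RSpace n → ℝ, IsTestFunction φ → (∀ x, 0 ≤ φ x) →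
      ∫ x, inner ℝ (h x) (gradient φ x) ≤ 0)
    {ψ : RSpace n → ℝ} (hψ : IsTestFunction ψ) (hψ0 : ∀ x, 0 ≤ ψ x) (hψ1 : ∀ x, ψ x ≤ 1) :
    ∫ x, ψ x * inner ℝ (h x) (g x) ≤ ∫ x, 2 * M * (‖h x‖ * ‖fderiv ℝ ψ x‖) := by
  have hψd : ContDiff ℝ 1 ψ := hψ.1.of_le (by norm_cast)
  have hψ' : Continuous (fderiv ℝ ψ) := hψd.continuous_fderiv one_ne_zero
  have hψc' : HasCompactSupport (fderiv ℝ ψ) := hψ.2.fderiv ℝ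
  refine integral_mul_inner_le_of_mollify hp1 hP hL hlog hug.locallyIntegrable_grad hgp hh hb hhg
    hψ.1.continuous hψ.2 hψ0 hψ1 fun k => ?_
  set v : RSpace n → ℝ := mollifier n k ⋆[lsmul ℝ ℝ, volume] u with hv
  set w : RSpace n → RSpace n := mollifier n k ⋆[lsmul ℝ ℝ, volume] g with hw
  have hmt := isTestFunction_mollifier (n := n) k
  have hvs : ContDiff ℝ ∞ v := hmt.2.contDiff_convolution_left _ hmt.1 hug.locallyIntegrable
  have hvd : ContDiff ℝ 1 v := hvs.of_le (by norm_cast)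
  have hvb : ∀ x, |v x| ≤ M := abs_mollify_le hM k
  have hwc : Continuous w :=
    hmt.2.continuous_convolution_left _ hmt.1.continuous hug.locallyIntegrable_grad
  -- Mollification keeps |v| ≤ M, so 0 ≤ v + M ≤ 2M: the test function is admissible and the
  -- resulting bound is independent of k.
  have htest : IsTestFunction fun x => ψ x * (v x + M) :=
    ⟨hψ.1.mul (hvs.add contDiff_const), hψ.2.mul_right⟩
  have h1 := hsub _ htest fun x => mul_nonneg (hψ0 x) (by linarith [(abs_le.1 (hvb x)).1])
  have hder : ∀ x, inner ℝ (h x) (gradient (fun x => ψ x * (v x + M)) x)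
      = ψ x * inner ℝ (h x) (w x) + ((v x + M) • fderiv ℝ ψ x) (h x) := fun x => by
    rw [real_inner_comm, inner_gradient_left]
    have h2 : HasFDerivAt (fun x => ψ x * (v x + M))
        (ψ x • fderiv ℝ v x + (v x + M) • fderiv ℝ ψ x) x :=
      ((hψd.differentiable one_ne_zero) x).hasFDerivAt.mul
        (((hvd.differentiable one_ne_zero) x).hasFDerivAt.add_const M)
    rw [h2.fderiv, add_apply, smul_apply, smul_eq_mul, hug.fderiv_convolution hmt x (h x),
      real_inner_comm]
  have hi1 : Integrable fun x => ψ x * inner ℝ (h x) (w x) :=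
    integrable_mul_inner hh hwc hψ.1.continuous hψ.2
  have hsupp : Function.support (fun x => (v x + M) • fderiv ℝ ψ x)
      ⊆ Function.support (fderiv ℝ ψ) := fun x hx hx0 => hx (by simp only [hx0, smul_zero])
  have hi2 : Integrable fun x => ((v x + M) • fderiv ℝ ψ x) (h x) :=
    integrable_clm_apply hh (T := fun x => (v x + M) • fderiv ℝ ψ x)
      ((hvs.continuous.add continuous_const).smul hψ') (hψc'.mono hsupp)
  have hi3 : Integrable fun x => 2 * M * (‖h x‖ * ‖fderiv ℝ ψ x‖) := by
    have : Integrable fun x => ‖fderiv ℝ ψ x‖ • ‖h x‖ :=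
      LocallyIntegrable.integrable_smul_left_of_hasCompactSupport
        (f := fun x => ‖h x‖) (fun x => (hh x).norm) hψ'.norm hψc'.norm
    simpa [mul_comm] using this.const_mul (2 * M)
  simp only [hder] at h1
  rw [integral_add hi1 hi2] at h1
  have h3 : -∫ x, ((v x + M) • fderiv ℝ ψ x) (h x) ≤ ∫ x, 2 * M * (‖h x‖ * ‖fderiv ℝ ψ x‖) := by
    rw [← integral_neg]
    suffices hle : ∀ x, -((v x + M) • fderiv ℝ ψ x) (h x) ≤ 2 * M * (‖h x‖ * ‖fderiv ℝ ψ x‖) from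
      integral_mono hi2.neg hi3 hle
    intro x
    refine (neg_le_abs _).trans ?_
    rw [smul_apply, smul_eq_mul, abs_mul, mul_comm ‖h x‖]
    have hb' := abs_le.1 (hvb x)
    gcongr
    · linarith
    · rw [abs_le]
      constructor <;> linarith
    · exact (fderiv ℝ ψ x).le_opNorm (h x)
  linarith

/-! ### Caccioppoli estimate and vanishing of the gradient. -/

/-- A bounded subsolution of `div h ≥ 0` with `p(·)`-growth and `p ≥ c > n` has zero gradient. -/
theorem ae_eq_zero_of_subsolution {p : RSpace n → ℝ} {c P L a b M : ℝ} (hpc : Continuous p)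
    (hp1 : ∀ x, 1 < p x) (hcn : (n : ℝ) < c) (hc : ∀ x, c ≤ p x) (hP : ∀ x, p x ≤ P) (hL : 0 < L)
    (hlog : ∀ x y, |1 / p x - 1 / p y| ≤ L / Real.log (Real.exp 1 + 1 / ‖x - y‖))
    {u : RSpace n → ℝ} {g h : RSpace n → RSpace n} (hug : IsWeakGradient u g)
    (hgp : ∀ K : Set (RSpace n), IsCompact K → IntegrableOn (fun x => ‖g x‖ ^ p x) K)
    (hh : LocallyIntegrable h) (ha : 0 < a) (hb : 0 < b)
    (hhg : ∀ x, ‖h x‖ ≤ b * ‖g x‖ ^ (p x - 1))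
    (hhga : ∀ x, a * ‖g x‖ ^ p x ≤ inner ℝ (h x) (g x))
    (hM0 : 0 < M) (hM : ∀ᵐ x ∂(volume : Measure (RSpace n)), |u x| ≤ M)
    (hsub : ∀ φ : RSpace n → ℝ, IsTestFunction φ → (∀ x, 0 ≤ φ x) →
      ∫ x, inner ℝ (h x) (gradient φ x) ≤ 0) :
    ∀ᵐ x ∂(volume : Measure (RSpace n)), g x = 0 := by
  have hP1 : 1 < P := (hp1 0).trans_le (hP 0)
  have hc0 : 0 < c := (Nat.cast_nonneg n).trans_lt hcn
  obtain ⟨N, hN⟩ := exists_nat_ge P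
  have hN1 : 1 ≤ N := by
    have : (1 : ℝ) ≤ N := by linarith
    exact_mod_cast this
  have hN0 : (0 : ℝ) < N := by exact_mod_cast hN1
  obtain ⟨D, hD, hcut⟩ := exists_cutoff n
  -- The constant in 2M|h||∇η^N| ≤ κ|g|^(p-1)η^(N-1)|∇η|. Absorption uses a/2 in place of a, leaving
  -- half of the coercive term.
  set κ : ℝ := 2 * M * b * N with hκ
  have hκ0 : 0 < κ := by positivity
  set C : ℝ := κ * max 1 (κ / (a / 2)) ^ P with hC
  have hC0 : 0 ≤ C := by positivity
  set V : ℝ := (volume : Measure (RSpace n)).real (Metric.ball 0 1)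
  have hgloc : LocallyIntegrable fun x => ‖g x‖ ^ p x :=
    locallyIntegrable_iff.2 hgp
  have hdecay : ∀ r R : ℝ, r ≤ R → D ≤ R → 0 < R →
      a / 2 * ∫ x in Metric.closedBall (0 : RSpace n) r, ‖g x‖ ^ p x
        ≤ C * (D ^ c * 2 ^ n * V * R ^ (-(c - n))) := by
    intro r R hrR hDR hR
    obtain ⟨η, hη, hη0, hη1, hηone, hηD, hηz⟩ := hcut R hR
    have hηd : ContDiff ℝ 1 η := hη.1.of_le (by norm_cast)
    have hη' : Continuous (fderiv ℝ η) := hηd.continuous_fderiv one_ne_zero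
    have hψ : IsTestFunction fun x => η x ^ N := by
      refine ⟨hη.1.pow N, ?_⟩
      refine hη.2.mono fun x hx hx0 => hx ?_
      simp only [hx0]
      exact zero_pow (by omega)
    have hψd : ∀ x, fderiv ℝ (fun x => η x ^ N) x = (N * η x ^ (N - 1)) • fderiv ℝ η x := fun x => by
      have := (((hηd.differentiable one_ne_zero) x).hasFDerivAt.pow N).fderiv
      simpa using this
    have hmain := integral_mul_inner_le_of_bounded (fun x => (hp1 x).le) hP hL hlog hug hgp hh hb.le
      hhg hM hsub hψ (fun x => pow_nonneg (hη0 x) N) (fun x => pow_le_one₀ (hη0 x) (hη1 x))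
    have hi0 : Integrable fun x => η x ^ N * ‖g x‖ ^ p x :=
      hgloc.integrable_smul_left_of_hasCompactSupport hψ.1.continuous hψ.2
    have hgi : Integrable fun x => η x ^ N * inner ℝ (h x) (g x) := by
      refine (hi0.const_mul b).mono' (hψ.1.continuous.aestronglyMeasurable.mul
        (hh.aestronglyMeasurable.inner hug.locallyIntegrable_grad.aestronglyMeasurable))
        (Eventually.of_forall fun x => ?_)
      rw [norm_mul, Real.norm_of_nonneg (pow_nonneg (hη0 x) N), Real.norm_eq_abs]
      have h1 : |inner ℝ (h x) (g x)| ≤ b * ‖g x‖ ^ p x := by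
        refine (abs_real_inner_le_norm _ _).trans ?_
        rcases (norm_nonneg (g x)).eq_or_lt with h0 | h0
        · rw [← h0, mul_zero]; positivity
        · calc ‖h x‖ * ‖g x‖ ≤ b * ‖g x‖ ^ (p x - 1) * ‖g x‖ := by gcongr; exact hhg x
            _ = b * ‖g x‖ ^ p x := by
              rw [mul_assoc, ← Real.rpow_add_one h0.ne', sub_add_cancel]
      have := mul_le_mul_of_nonneg_left h1 (pow_nonneg (hη0 x) N)
      linarith
    have hDcont : Continuous fun x => ‖fderiv ℝ η x‖ ^ p x :=
      hη'.norm.rpow hpc fun x => Or.inr (zero_lt_one.trans (hp1 x))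
    have hDc : HasCompactSupport fun x => ‖fderiv ℝ η x‖ ^ p x := by
      refine (hη.2.fderiv ℝ).mono fun x hx hx0 => hx ?_
      simp only [hx0, norm_zero]
      exact Real.zero_rpow (zero_lt_one.trans (hp1 x)).ne'
    have hDi : Integrable fun x => ‖fderiv ℝ η x‖ ^ p x :=
      hDcont.integrable_of_hasCompactSupport hDc
    have hψ'i : Integrable fun x => 2 * M * (‖h x‖ * ‖fderiv ℝ (fun x => η x ^ N) x‖) := by
      have hd : ContDiff ℝ 1 fun x => η x ^ N := hψ.1.of_le (by norm_cast)
      have : Integrable fun x => ‖fderiv ℝ (fun x => η x ^ N) x‖ • ‖h x‖ :=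
        LocallyIntegrable.integrable_smul_left_of_hasCompactSupport
          (f := fun x => ‖h x‖) (fun x => (hh x).norm)
          (hd.continuous_fderiv one_ne_zero).norm (hψ.2.fderiv ℝ).norm
      simpa [mul_comm] using this.const_mul (2 * M)
    have hlow : a * ∫ x, η x ^ N * ‖g x‖ ^ p x ≤ ∫ x, η x ^ N * inner ℝ (h x) (g x) := by
      rw [← integral_const_mul]
      refine integral_mono (hi0.const_mul a) hgi fun x => ?_
      have := mul_le_mul_of_nonneg_left (hhga x) (pow_nonneg (hη0 x) N)
      simp only
      linarith
    have hup : ∫ x, 2 * M * (‖h x‖ * ‖fderiv ℝ (fun x => η x ^ N) x‖)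
        ≤ a / 2 * (∫ x, η x ^ N * ‖g x‖ ^ p x) + C * ∫ x, ‖fderiv ℝ η x‖ ^ p x := by
      rw [← integral_const_mul, ← integral_const_mul,
        ← integral_add (hi0.const_mul _) (hDi.const_mul _)]
      refine integral_mono hψ'i ((hi0.const_mul _).add (hDi.const_mul _)) fun x => ?_
      refine le_trans ?_ (mul_rpow_sub_one_le hκ0 (half_pos ha) (norm_nonneg (g x)) (hη0 x) (hη1 x)
        (norm_nonneg (fderiv ℝ η x)) (hp1 x) (hP x) hN)
      simp only
      rw [hψd, norm_smul, norm_mul, norm_pow, Real.norm_of_nonneg (hη0 x),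
        Real.norm_of_nonneg hN0.le]
      have h0 : 0 ≤ η x := hη0 x
      calc 2 * M * (‖h x‖ * (N * η x ^ (N - 1) * ‖fderiv ℝ η x‖))
          ≤ 2 * M * (b * ‖g x‖ ^ (p x - 1) * (N * η x ^ (N - 1) * ‖fderiv ℝ η x‖)) := by
            gcongr
            exact hhg x
        _ = _ := by rw [hκ]; ring
    have hball : ∫ x in Metric.closedBall (0 : RSpace n) r, ‖g x‖ ^ p x
        ≤ ∫ x, η x ^ N * ‖g x‖ ^ p x := by
      rw [← integral_indicator Metric.isClosed_closedBall.measurableSet]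
      refine integral_mono ((integrable_indicator_iff
        Metric.isClosed_closedBall.measurableSet).2 (hgp _ (isCompact_closedBall _ _))) hi0 ?_
      intro x
      by_cases hx : x ∈ Metric.closedBall (0 : RSpace n) r
      · have : η x = 1 := hηone x ((mem_closedBall_zero_iff.1 hx).trans hrR)
        simp [Set.indicator_of_mem hx, this]
      · rw [Set.indicator_of_notMem hx]
        have := hη0 x
        positivity
    -- With D/R ≤ 1, the exponent p(x) may be lowered to c; the ball of radius 2R contributes R^n,
    -- leaving R^(n-c).
    have hDint : ∫ x, ‖fderiv ℝ η x‖ ^ p x ≤ D ^ c * 2 ^ n * V * R ^ (-(c - n)) := by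
      have hDR' : D / R ≤ 1 := (div_le_one hR).2 hDR
      have hKm := (Metric.isClosed_closedBall (x := (0 : RSpace n))
        (ε := 2 * R)).measurableSet
      have h1 : ∫ x, ‖fderiv ℝ η x‖ ^ p x ≤
          ∫ x, (Metric.closedBall (0 : RSpace n) (2 * R)).indicator (fun _ => (D / R) ^ c) x := by
        refine integral_mono hDi ((integrable_indicator_iff hKm).2
          (integrableOn_const (isCompact_closedBall _ _).measure_lt_top.ne)) fun x => ?_
        by_cases hx : x ∈ Metric.closedBall (0 : RSpace n) (2 * R)
        · rw [Set.indicator_of_mem hx]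
          calc ‖fderiv ℝ η x‖ ^ p x ≤ (D / R) ^ p x :=
                Real.rpow_le_rpow (norm_nonneg _) (hηD x) (zero_lt_one.trans (hp1 x)).le
            _ ≤ (D / R) ^ c :=
                Real.rpow_le_rpow_of_exponent_ge (by positivity) hDR' (hc x)
        · rw [Set.indicator_of_notMem hx, hηz x (by simpa using hx), norm_zero,
            Real.zero_rpow (zero_lt_one.trans (hp1 x)).ne']
      refine h1.trans_eq ?_
      rw [integral_indicator hKm, setIntegral_const, smul_eq_mul, Measure.real,
        Measure.addHaar_closedBall _ _ (by positivity), ENNReal.toReal_mul,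
        ENNReal.toReal_ofReal (by positivity), finrank_euclideanSpace_fin,
        Real.div_rpow hD.le hR.le, mul_pow, neg_sub, Real.rpow_sub hR, Real.rpow_natCast]
      simp only [V, Measure.real]
      ring
    have h5 := mul_le_mul_of_nonneg_left hball (half_pos ha).le
    have h6 := mul_le_mul_of_nonneg_left hDint hC0
    linarith
  have hzero : ∀ r : ℝ, ∫ x in Metric.closedBall (0 : RSpace n) r, ‖g x‖ ^ p x = 0 := fun r => by
    refine le_antisymm ?_ (integral_nonneg fun x => by positivity)
    have hlim : Tendsto (fun R : ℝ => C * (D ^ c * 2 ^ n * V * R ^ (-(c - n)))) atTop (𝓝 0) := by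
      have := ((tendsto_rpow_neg_atTop (sub_pos.2 hcn)).const_mul (D ^ c * 2 ^ n * V)).const_mul C
      simpa using this
    have h1 := ge_of_tendsto hlim (b := a / 2 * ∫ x in Metric.closedBall (0 : RSpace n) r,
        ‖g x‖ ^ p x) (by
      filter_upwards [eventually_ge_atTop r, eventually_ge_atTop D, eventually_gt_atTop 0]
        with R h1 h2 h3 using hdecay r R h1 h2 h3)
    exact nonpos_of_mul_nonpos_right h1 (half_pos ha)
  have hball : ∀ k : ℕ, ∀ᵐ x ∂(volume : Measure (RSpace n)),
      x ∈ Metric.closedBall (0 : RSpace n) k → g x = 0 := fun k => by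
    have h1 := (setIntegral_eq_zero_iff_of_nonneg_ae (μ := volume)
      (s := Metric.closedBall (0 : RSpace n) k) (f := fun x => ‖g x‖ ^ p x)
      (Eventually.of_forall fun x => by positivity) (hgp _ (isCompact_closedBall _ _))).1 (hzero k)
    rw [Filter.EventuallyEq, ae_restrict_iff' Metric.isClosed_closedBall.measurableSet] at h1
    filter_upwards [h1] with x hx hxk
    have := (Real.rpow_eq_zero_iff_of_nonneg (norm_nonneg _)).1 (hx hxk)
    exact norm_eq_zero.1 this.1
  filter_upwards [ae_all_iff.2 hball] with x hx
  obtain ⟨k, hk⟩ := exists_nat_ge ‖x‖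
  exact hx k (by simpa using hk)

/-! ### From vanishing gradient to u = t. -/

/-- A nonnegative locally bounded function is a.e. zero if its integrals against nonnegative
test functions are nonpositive. -/
theorem ae_eq_zero_of_integral_mul_nonpos {F : RSpace n → ℝ} (hF : LocallyIntegrable F)
    (hF0 : ∀ x, 0 ≤ F x)
    (h : ∀ φ : RSpace n → ℝ, IsTestFunction φ → (∀ x, 0 ≤ φ x) → ∫ x, F x * φ x ≤ 0) :
    ∀ᵐ x ∂(volume : Measure (RSpace n)), F x = 0 := by
  obtain ⟨D, hD, hcut⟩ := exists_cutoff n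
  -- Radius k + 1 rather than k, because cutoffs need a positive radius.
  have hk : ∀ k : ℕ, ∀ᵐ x ∂(volume : Measure (RSpace n)), ‖x‖ ≤ (k : ℝ) + 1 → F x = 0 := fun k => by
    obtain ⟨η, hη, hη0, -, hηone, -⟩ := hcut (k + 1) (by positivity)
    have hi : Integrable fun x => F x * η x := by
      have : Integrable fun x => η x • F x :=
        hF.integrable_smul_left_of_hasCompactSupport hη.1.continuous hη.2
      simpa [mul_comm] using this
    have hnn : 0 ≤ fun x => F x * η x := fun x => mul_nonneg (hF0 x) (hη0 x)
    have h0 : ∫ x, F x * η x = 0 := le_antisymm (h η hη hη0) (integral_nonneg hnn)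
    filter_upwards [(integral_eq_zero_iff_of_nonneg hnn hi).1 h0] with x hx hxk
    simpa [hηone x hxk] using hx
  filter_upwards [ae_all_iff.2 hk] with x hx
  obtain ⟨k, hk⟩ := exists_nat_ge ‖x‖
  exact hx k (by linarith)

theorem locallyIntegrable_of_bounded {F : RSpace n → ℝ} (hF : AEStronglyMeasurable F volume)
    {C : ℝ} (hC : ∀ᵐ x ∂(volume : Measure (RSpace n)), |F x| ≤ C) : LocallyIntegrable F := by
  rw [locallyIntegrable_iff]
  intro K hK
  exact (integrableOn_const (C := C) hK.measure_lt_top.ne).mono' hF.restrict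
    (ae_restrict_of_ae hC)

end VarExp

end

theorem theorem4p4 {n : ℕ} (hn : 1 ≤ n)
    (p : RSpace n → ℝ) (hp : VarExp.IsBoundedLogHolderExponent p)
    (hpn : (n : ℝ) < VarExp.pMinus p)
    (A : RSpace n → ℝ → RSpace n → RSpace n) (hA : VarExp.HasVarGrowth p A)
    (f : ℝ → ℝ) (hf : Continuous f) (hf0 : ∀ s, 0 ≤ f s) (hft : ∃! t : ℝ, f t = 0)
    (u : RSpace n → ℝ) (hu : VarExp.IsSupersolution p A f u)
    (hub : ∃ M : ℝ, ∀ᵐ x ∂(MeasureTheory.volume : MeasureTheory.Measure (RSpace n)), |u x| ≤ M) :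
    ∃ t : ℝ, f t = 0 ∧
      ∀ᵐ x ∂(MeasureTheory.volume : MeasureTheory.Measure (RSpace n)), u x = t := by
  open VarExp MeasureTheory in
  obtain ⟨t, ht, htu⟩ := hft
  refine ⟨t, ht, ?_⟩
  obtain ⟨g, hg, hsup⟩ := hu
  obtain ⟨M₀, hM₀⟩ := hub
  set M : ℝ := max 1 M₀
  have hM : ∀ᵐ x ∂(volume : Measure (RSpace n)), |u x| ≤ M :=
    hM₀.mono fun x hx => hx.trans (le_max_right _ _)
  have hM0 : 0 < M := zero_lt_one.trans_le (le_max_left _ _)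
  obtain ⟨a, b, -, -, ⟨a₀, ha₀, haa⟩, ⟨b₀, hbb⟩, -, hcoer, hgrow⟩ := hA.growth
  obtain ⟨P, hP⟩ := hp.exists_upper
  obtain ⟨L, hL, hlog⟩ := hp.logHolder
  have hp1 : ∀ x, 1 < p x := fun x => hp.one_lt_pMinus.trans_le (hp.pMinus_le x)
  have hug := hg.weakGradient
  have hgp : ∀ K : Set (RSpace n), IsCompact K → IntegrableOn (fun x => ‖g x‖ ^ p x) K :=
    fun K hK => (hg.memVarLp_grad K hK).integrableOn_rpow hp.continuous hp.one_le hP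
  set B : ℝ := max 1 b₀
  have hB : 0 < B := zero_lt_one.trans_le (le_max_left _ _)
  let h : RSpace n → RSpace n := fun x => A x (u x) (g x)
  have hhg : ∀ x, ‖h x‖ ≤ B * ‖g x‖ ^ (p x - 1) := fun x => by
    refine (hgrow x (u x) (g x)).trans ?_
    gcongr
    exact (hbb x).trans (le_max_right _ _)
  have hhga : ∀ x, a₀ * ‖g x‖ ^ p x ≤ inner ℝ (h x) (g x) := fun x => by
    refine le_trans ?_ (hcoer x (u x) (g x))
    gcongr
    exact haa x
  have hhm : AEStronglyMeasurable h volume :=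
    (hA.caratheodory.aemeasurable_comp hug.locallyIntegrable.aestronglyMeasurable.aemeasurable
      hug.locallyIntegrable_grad.aestronglyMeasurable.aemeasurable).aestronglyMeasurable
  have hh : LocallyIntegrable h := by
    rw [locallyIntegrable_iff]
    intro K hK
    refine (((hgp K hK).add (integrableOn_const (C := (1 : ℝ)) hK.measure_lt_top.ne)).const_mul
      B).mono' hhm.restrict (Eventually.of_forall fun x => (hhg x).trans ?_)
    have := rpow_sub_one_mul_le (norm_nonneg (g x)) zero_le_one (hp1 x).le
    rw [mul_one, Real.one_rpow] at this
    exact mul_le_mul_of_nonneg_left this hB.le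
  -- Nonnegativity of f lets its term be dropped here; it returns once the gradient is known to
  -- vanish.
  have hg0 := ae_eq_zero_of_subsolution hp.continuous hp1 hpn hp.pMinus_le hP hL hlog hug hgp hh
    ha₀ hB hhg hhga hM0 hM fun φ hφ hφ0 => by
      have h1 := hsup φ hφ hφ0
      have h2 : 0 ≤ ∫ x, f (u x) * φ x := integral_nonneg fun x => mul_nonneg (hf0 _) (hφ0 x)
      linarith
  have hh0 : ∀ᵐ x ∂(volume : Measure (RSpace n)), h x = 0 := by
    filter_upwards [hg0] with x hx
    have := hhg x
    rw [hx, norm_zero, Real.zero_rpow (by linarith [hp1 x]), mul_zero] at this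
    exact norm_le_zero_iff.1 this
  obtain ⟨C, hC⟩ := (isCompact_Icc (a := -M) (b := M)).exists_bound_of_continuousOn hf.continuousOn
  have hfu : LocallyIntegrable fun x => f (u x) :=
    locallyIntegrable_of_bounded
      (hf.comp_aestronglyMeasurable hug.locallyIntegrable.aestronglyMeasurable)
      (hM.mono fun x hx => hC (u x) (abs_le.1 hx))
  -- With h = 0 the supersolution inequality reads ∫f(u)φ ≤ 0. This identifies u through the unique
  -- zero of f, without first deducing constancy from ∇u = 0.
  filter_upwards [ae_eq_zero_of_integral_mul_nonpos hfu (fun x => hf0 _) fun φ hφ hφ0 => by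
    refine (hsup φ hφ hφ0).trans_eq ?_
    rw [neg_eq_zero]
    refine integral_eq_zero_of_ae ?_
    filter_upwards [hh0] with x hx
    change inner ℝ (h x) _ = 0
    rw [hx, inner_zero_left]] with x hx
  exact htu _ hx
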